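/- \textbf{Selective Delaunay Collapsing Theorem.} Let $X\subseteq\mathbb R^n$ be a finite set of weighted points: each $x\in X$ carries a weight $w_x\in\mathbb R$ (the unweighted case is $w=0$). For $x\in X$ and $y\in\mathbb R^n$ put $\pi_x(y)=\|y-x\|^2-w_x$. The sphere with center $z\in\mathbb R^n$ and squared radius $s\in\mathbb R$ (possibly negative) is a circumsphere of $Q\subseteq X$ if $\pi_x(z)=s$ for all $x\in Q$; it is a smallest circumsphere of $Q$ if $s$ is minimal among the squared radii of all circumspheres of $Q$. Assume that $X$ is in general position: every $Q\subseteq X$ with at most $n+1$ points is affinely independent, and $\pi_p(z)\neq s$ for each $p\in X\setminus Q$ whenever $(z,s)$ is a smallest circumsphere of $Q$. For $E\subseteq X$ and $s\in\mathbb R$ let $\mathrm{Vor}(x,E)=\{y\in\mathbb R^n \mid \pi_x(y)\le\pi_p(y)\text{ for all }p\in E\}$ and $\mathrm{Vor}^{s}(x,E)=\{y\in\mathrm{Vor}(x,E)\mid \pi_x(y)\le s\}$. Let $\mathrm{Del}^{s}(X,E)$ be the simplicial complex of all nonempty $Q\subseteq X$ with $\bigcap_{x\in Q}\mathrm{Vor}^{s}(x,E)\ne\emptyset$,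 and $\mathrm{Del}(X,E)$ the simplicial complex of all nonempty $Q\subseteq X$ with $\bigcap_{x\in Q}\mathrm{Vor}(x,E)\neq\emptyset$. Here $s$ is the squared radius, so that the selective Delaunay complex for radius $r$ is $\mathrm{Del}_r(X,E)=\mathrm{Del}^{r^2}(X,E)$. Write $K\searrow L$ if $L$ is obtained from the simplicial complex $K$ by a finite (possibly empty) sequence of elementary collapses, each of which removes two nonempty simplices $P\subset Q$ with $\dim Q=\dim P+1$ such that $P$ and $Q$ are the only simplices of the current complex that contain $P$. Then for all $E\subseteq F\subseteq X$ and every $s\in\mathbb R$, $$\mathrm{Del}^{s}(X,E)\ \searrow\ \mathrm{Del}^{s}(X,E)\cap\mathrm{Del}(X,F)\ \searrow\ \mathrm{Del}^{s}(X,F).$$ In particular, $\mathrm{Del}_r(X,E)\searrow \mathrm{Del}_r(X,E)\cap\mathrm{Del}(X,F)\searrow \mathrm{Del}_r(X,F)$ for every $r$. -/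

import Mathlib

/-! Selective Delaunay complexes of finite sets of weighted points in `ℝⁿ`, and simplicial collapses.

A weighted point is a point `x` of `ℝⁿ` together with its weight `w x`, where `w` is a real function.
The unweighted case is `w = 0`. -/

/-- The power distance of `y` from the weighted point `x`; for `w x = 0` it is the squared
Euclidean distance. -/
noncomputable def powerDist {n : ℕ} (w : EuclideanSpace ℝ (Fin n) → ℝ)
    (x y : EuclideanSpace ℝ (Fin n)) : ℝ :=
  dist y x ^ 2 - w x

/-- The ball around the weighted point `x` for the squared radius `s` (which may be negative):
all `y` with `‖y - x‖² ≤ s + w x`. -/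
def weightedBall {n : ℕ} (w : EuclideanSpace ℝ (Fin n) → ℝ) (s : ℝ)
    (x : EuclideanSpace ℝ (Fin n)) : Set (EuclideanSpace ℝ (Fin n)) :=
  {y | powerDist w x y ≤ s}

/-- The (weighted) Voronoi domain of `x` with respect to `E`, where `x` need not belong to `E`. -/
def voronoiDomain {n : ℕ} (w : EuclideanSpace ℝ (Fin n) → ℝ)
    (E : Finset (EuclideanSpace ℝ (Fin n)))
    (x : EuclideanSpace ℝ (Fin n)) : Set (EuclideanSpace ℝ (Fin n)) :=
  {y | ∀ p ∈ E, powerDist w x y ≤ powerDist w p y}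

/-- The (weighted) Voronoi ball of `x` with respect to `E` for the squared radius `s`. -/
def voronoiBall {n : ℕ} (w : EuclideanSpace ℝ (Fin n) → ℝ)
    (E : Finset (EuclideanSpace ℝ (Fin n))) (s : ℝ)
    (x : EuclideanSpace ℝ (Fin n)) : Set (EuclideanSpace ℝ (Fin n)) :=
  weightedBall w s x ∩ voronoiDomain w E x

/-- The nerve, over the vertex set `X`, of a family of sets: the nonempty `Q ⊆ X` such that the
sets indexed by the elements of `Q` have a common point. -/
def nerveComplex {α β : Type*} (X : Finset α) (U : α → Set β) : PreAbstractSimplicialComplex α where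
  faces := {Q | Q.Nonempty ∧ Q ⊆ X ∧ (⋂ x ∈ Q, U x).Nonempty}
  isRelLowerSet_faces := by
    rintro Q ⟨hne, hQX, hU⟩
    exact ⟨hne, fun P hPQ hP => ⟨hP, hPQ.trans hQX,
      hU.mono (Set.biInter_subset_biInter_left hPQ)⟩⟩

/-- The selective Delaunay complex `Del_r(X, E)`, where `s` is the squared radius `r²`. -/
def selectiveDelaunay {n : ℕ} (w : EuclideanSpace ℝ (Fin n) → ℝ)
    (X E : Finset (EuclideanSpace ℝ (Fin n))) (s : ℝ) :
    PreAbstractSimplicialComplex (EuclideanSpace ℝ (Fin n)) :=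
  nerveComplex X (voronoiBall w E s)

/-- The selective Delaunay complex `Del(X, E) = Del_∞(X, E)` without a bound on the radius. -/
def selectiveDelaunayTop {n : ℕ} (w : EuclideanSpace ℝ (Fin n) → ℝ)
    (X E : Finset (EuclideanSpace ℝ (Fin n))) :
    PreAbstractSimplicialComplex (EuclideanSpace ℝ (Fin n)) :=
  nerveComplex X (voronoiDomain w E)

/-- The sphere with center `z` and squared radius `s` is a circumsphere of `Q`: each weighted point
`x` of `Q` lies on it, that is, `‖z - x‖² = s + w x`. -/
def IsCircumsphere {n : ℕ} (w : EuclideanSpace ℝ (Fin n) → ℝ)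
    (Q : Finset (EuclideanSpace ℝ (Fin n))) (z : EuclideanSpace ℝ (Fin n)) (s : ℝ) : Prop :=
  ∀ x ∈ Q, powerDist w x z = s

/-- The sphere with center `z` and squared radius `s` is a smallest circumsphere of `Q`. -/
def IsSmallestCircumsphere {n : ℕ} (w : EuclideanSpace ℝ (Fin n) → ℝ)
    (Q : Finset (EuclideanSpace ℝ (Fin n))) (z : EuclideanSpace ℝ (Fin n)) (s : ℝ) : Prop :=
  IsCircumsphere w Q z s ∧ ∀ z' s', IsCircumsphere w Q z' s' → s ≤ s'

/-- General position of a finite set of weighted points: every subset of at most `n + 1` points is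
affinely independent, and no other point lies on its smallest circumsphere. -/
def InGeneralPosition {n : ℕ} (w : EuclideanSpace ℝ (Fin n) → ℝ)
    (X : Finset (EuclideanSpace ℝ (Fin n))) : Prop :=
  ∀ Q : Finset (EuclideanSpace ℝ (Fin n)), Q ⊆ X → Q.card ≤ n + 1 →
    AffineIndependent ℝ (fun x : Q => (x : EuclideanSpace ℝ (Fin n))) ∧
    ∀ z s, IsSmallestCircumsphere w Q z s → ∀ p ∈ X, p ∉ Q → powerDist w p z ≠ s

/-- `L` arises from `K` by an elementary collapse: `P` is a facet of `Q`, the only simplices of `K`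
that contain `P` are `P` and `Q`, and `L` is `K` without these two simplices. -/
def ElementaryCollapse {α : Type*} (K L : PreAbstractSimplicialComplex α) : Prop :=
  ∃ P Q : Finset α, P ∈ K ∧ Q ∈ K ∧ P ⊆ Q ∧ Q.card = P.card + 1 ∧
    (∀ R ∈ K, P ⊆ R → R = P ∨ R = Q) ∧
    ∀ R, R ∈ L ↔ R ∈ K ∧ R ≠ P ∧ R ≠ Q

/-- `K ↘ L`: a finite (possibly empty) sequence of elementary collapses leads from `K` to `L`. -/
def Collapses {α : Type*} (K L : PreAbstractSimplicialComplex α) : Prop :=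
  Relation.ReflTransGen ElementaryCollapse K L

/-! Encode a sphere by `(z, s - ‖z‖²)`. Including or excluding a weighted point becomes an affine
inequality, while the squared radius is convex and strictly convex in the center. A simplex `Q` lies
in `Del^s(X, E)` iff some sphere of squared radius at most `s` includes `Q` and excludes `E`; the
smallest such sphere is unique.

Each collapse pairs the simplices to be removed by toggling one vertex (`collapses_of_pairing`). The
vertex must leave two convex minimization problems unchanged, one of them the smallest sphere for
`E`. The sum of the two minimal values increases along faces, and it is constant only if both values
are; the vertex choice can therefore be made constant on such faces.

For the second collapse the other problem is the smallest sphere for `F`, whose radius exceeds that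
of the smallest sphere for `E`. The identity `IsBalanced.sqRadius_sub`, applied to the
Karush–Kuhn–Tucker coefficients, then yields a point strictly inside the `E`-sphere with negative
coefficient on the `F`-sphere. General position makes the coefficients unique, so that this point
can be toggled.

For the first collapse no sphere separates `Q` from `F`. Instead a convex quadratic penalty for
points of `F` inside the sphere is minimized. Some penalized point is also strictly inside the
smallest `E`-sphere, and toggling it changes neither minimum. -/

/-! ### Collapses from a vertex pairing. -/

/-- Among the simplices of `D` with maximal `f`, one of maximal cardinality contains its own vertex
`p Q`, and deleting that vertex gives a free face. Removing this pair leaves a smaller instance of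
the same situation. -/
theorem collapses_of_pairing_aux {α : Type*} [DecidableEq α] [Nonempty α]
    (L : PreAbstractSimplicialComplex α) (f : Finset α → ℝ) (p : Finset α → α)
    (D : Finset (Finset α)) :
    ∀ K : PreAbstractSimplicialComplex α,
      (∀ R, R ∈ L ↔ R ∈ K ∧ R ∉ D) → (∀ R ∈ D, R ∈ K) →
      (∀ Q ∈ D, ∀ R ∈ D, Q ⊆ R → f Q ≤ f R) →
      (∀ Q ∈ D, ∀ R ∈ D, Q ⊆ R → f Q = f R → p Q = p R) →
      (∀ Q ∈ D, insert (p Q) Q ∈ D ∧ f (insert (p Q) Q) = f Q) →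
      (∀ Q ∈ D, Q.erase (p Q) ∈ D ∧ f (Q.erase (p Q)) = f Q) →
      Collapses K L := by
  induction D using Finset.strongInduction with
  | H D ih =>
  intro K hL hDK hmono hp hins hera
  rcases D.eq_empty_or_nonempty with rfl | hne
  · have : K = L := by
      apply SetLike.ext
      intro R
      simp [hL]
    rw [this]
    exact Relation.ReflTransGen.refl
  obtain ⟨Q₀, hQ₀, hQ₀max⟩ := D.exists_max_image f hne
  obtain ⟨Q, hQ, hQmax⟩ := (D.filter fun R => f R = f Q₀).exists_max_image Finset.card
    ⟨Q₀, by simp [hQ₀]⟩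
  rw [Finset.mem_filter] at hQ
  obtain ⟨hQD, hfQ⟩ := hQ
  have hmem : p Q ∈ Q := by
    by_contra h
    have h1 := hins Q hQD
    have h2 := hQmax _ (Finset.mem_filter.2 ⟨h1.1, h1.2.trans hfQ⟩)
    rw [Finset.card_insert_of_notMem h] at h2
    omega
  set P := Q.erase (p Q) with hP
  obtain ⟨hPD, hfP⟩ := hera Q hQD
  have hPQ : P ⊆ Q := Finset.erase_subset _ _
  have hpP : p P = p Q := hp P hPD Q hQD hPQ hfP
  -- A coface `R` of `P` is in `D`, since `L` is closed under faces, and has maximal `f`, hence the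
  -- same vertex as `P`. Adding that vertex gives a simplex containing `Q`, which is `Q` by maximal
  -- cardinality.
  have hcof : ∀ R ∈ K, P ⊆ R → R = P ∨ R = Q := by
    intro R hR hPR
    have hRD : R ∈ D := by
      by_contra h
      have hRL := (hL R).2 ⟨hR, h⟩
      have hPL : P ∈ L := (L.isRelLowerSet_faces hRL).2 hPR (K.isRelLowerSet_faces (hDK P hPD)).1
      exact ((hL P).1 hPL).2 hPD
    have hfR : f R = f Q₀ :=
      le_antisymm (hQ₀max R hRD) (by rw [← hfQ, ← hfP]; exact hmono P hPD R hRD hPR)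
    have hpR : p R = p Q := by
      rw [← hpP]
      exact (hp P hPD R hRD hPR (by rw [hfR, hfP, hfQ])).symm
    have hi := hins R hRD
    rw [hpR] at hi
    have hsub : Q ⊆ insert (p Q) R :=
      (Finset.insert_erase hmem).symm.subset.trans (Finset.insert_subset_insert _ hPR)
    have heq : Q = insert (p Q) R := Finset.eq_of_subset_of_card_le hsub
      (hQmax _ (Finset.mem_filter.2 ⟨hi.1, hi.2.trans hfR⟩))
    by_cases h : p Q ∈ R
    · right
      rw [heq, Finset.insert_eq_of_mem h]
    · left
      have := Finset.erase_insert h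
      rw [← heq] at this
      exact this.symm
  have hPne : P ≠ Q := fun h => Finset.notMem_erase (p Q) Q (by rw [← hP, h]; exact hmem)
  let K' : PreAbstractSimplicialComplex α :=
    { faces := {R | R ∈ K ∧ R ≠ P ∧ R ≠ Q}
      isRelLowerSet_faces := by
        rintro R ⟨hR, hRP, hRQ⟩
        refine ⟨(K.isRelLowerSet_faces hR).1, fun S hSR hS => ?_⟩
        refine ⟨(K.isRelLowerSet_faces hR).2 hSR hS, ?_, ?_⟩
        · rintro rfl
          rcases hcof R hR hSR with h | h
          exacts [hRP h, hRQ h]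
        · rintro rfl
          rcases hcof R hR (hPQ.trans hSR) with h | h
          exacts [hRP h, hRQ h] }
  have hK' : ∀ R, R ∈ K' ↔ R ∈ K ∧ R ≠ P ∧ R ≠ Q := fun R => Iff.rfl
  have hstep : ElementaryCollapse K K' :=
    ⟨P, Q, hDK P hPD, hDK Q hQD, hPQ, by
      rw [hP, Finset.card_erase_of_mem hmem]
      have := Finset.card_pos.2 ⟨_, hmem⟩
      omega, hcof, hK'⟩
  have hD' : ∀ R, R ∈ (D.erase P).erase Q ↔ R ∈ D ∧ R ≠ P ∧ R ≠ Q := by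
    intro R
    simp only [Finset.mem_erase]
    tauto
  refine Relation.ReflTransGen.head hstep (ih ((D.erase P).erase Q) ?_ K' ?_ ?_ ?_ ?_ ?_ ?_)
  · exact ((D.erase P).erase_subset Q).trans_ssubset (Finset.erase_ssubset hPD)
  · intro R
    rw [hL, hK', hD']
    constructor
    · rintro ⟨h1, h2⟩
      exact ⟨⟨h1, fun h => h2 (h ▸ hPD), fun h => h2 (h ▸ hQD)⟩, fun h => h2 h.1⟩
    · rintro ⟨⟨h1, h2, h3⟩, h4⟩
      exact ⟨h1, fun h => h4 ⟨h, h2, h3⟩⟩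
  · intro R hR
    rw [hD'] at hR
    exact ⟨hDK R hR.1, hR.2⟩
  · intro R hR S hS
    exact hmono R ((hD' R).1 hR).1 S ((hD' S).1 hS).1
  · intro R hR S hS
    exact hp R ((hD' R).1 hR).1 S ((hD' S).1 hS).1
  · intro R hR
    obtain ⟨hRD, hRP, hRQ⟩ := (hD' R).1 hR
    obtain ⟨h1, h2⟩ := hins R hRD
    have h3 := hp R hRD _ h1 (Finset.subset_insert _ _) h2.symm
    refine ⟨(hD' _).2 ⟨h1, fun h => ?_, fun h => ?_⟩, h2⟩
    · rw [h, hpP] at h3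
      have := Finset.mem_insert_self (p R) R
      rw [h, h3] at this
      exact Finset.notMem_erase _ _ this
    · rw [h] at h3
      by_cases hm : p R ∈ R
      · rw [Finset.insert_eq_of_mem hm] at h
        exact hRQ h
      · apply hRP
        rw [hP, ← h3, ← h, Finset.erase_insert hm]
  · intro R hR
    obtain ⟨hRD, hRP, hRQ⟩ := (hD' R).1 hR
    obtain ⟨h1, h2⟩ := hera R hRD
    have h3 := hp _ h1 R hRD (Finset.erase_subset _ _) h2
    refine ⟨(hD' _).2 ⟨h1, fun h => ?_, fun h => ?_⟩, h2⟩
    · rw [h, hpP] at h3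
      by_cases hm : p R ∈ R
      · apply hRQ
        rw [← Finset.insert_erase hm, h, ← h3, Finset.insert_erase hmem]
      · rw [Finset.erase_eq_of_notMem hm] at h
        exact hRP h
    · rw [h] at h3
      have := Finset.notMem_erase (p R) R
      rw [h, ← h3] at this
      exact this hmem

/-- If the simplices of `K` that are not in `L` carry a monotone function `f` and a nonempty set
`T Q` of vertices each of which can be added to or removed from `Q` without leaving the level set,
and `T` is constant along faces of equal value, then `K` collapses to `L`. -/
theorem collapses_of_pairing {α : Type*} [DecidableEq α] [Nonempty α]
    (K L : PreAbstractSimplicialComplex α) (hLK : L ≤ K) (hK : K.faces.Finite)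
    (f : Finset α → ℝ) (T : Finset α → Set α)
    (hmono : ∀ Q ∈ K, Q ∉ L → ∀ R ∈ K, R ∉ L → Q ⊆ R → f Q ≤ f R)
    (hT : ∀ Q ∈ K, Q ∉ L → ∀ R ∈ K, R ∉ L → Q ⊆ R → f Q = f R → T Q = T R)
    (hne : ∀ Q ∈ K, Q ∉ L → (T Q).Nonempty)
    (hins : ∀ Q ∈ K, Q ∉ L → ∀ x ∈ T Q,
      insert x Q ∈ K ∧ insert x Q ∉ L ∧ f (insert x Q) = f Q)
    (hera : ∀ Q ∈ K, Q ∉ L → ∀ x ∈ T Q,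
      Q.erase x ∈ K ∧ Q.erase x ∉ L ∧ f (Q.erase x) = f Q) :
    Collapses K L := by
  classical
  have hD : ∀ R, R ∈ hK.toFinset.filter (fun R => R ∉ L) ↔ R ∈ K ∧ R ∉ L := by
    intro R
    rw [Finset.mem_filter, Set.Finite.mem_toFinset]
    exact Iff.rfl
  -- The choice by `Classical.epsilon` depends on the set `T Q` alone, so equal sets yield the same
  -- vertex.
  have hε : ∀ Q ∈ K, Q ∉ L → Classical.epsilon (fun x => x ∈ T Q) ∈ T Q :=
    fun Q h1 h2 => Classical.epsilon_spec (hne Q h1 h2)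
  refine collapses_of_pairing_aux L f (fun Q => Classical.epsilon fun x => x ∈ T Q)
    (hK.toFinset.filter fun R => R ∉ L) K ?_ ?_ ?_ ?_ ?_ ?_
  · intro R
    rw [hD]
    exact ⟨fun h => ⟨hLK h, fun h' => h'.2 h⟩, fun h => by_contra fun h' => h.2 ⟨h.1, h'⟩⟩
  · exact fun R hR => ((hD R).1 hR).1
  · intro Q hQ R hR
    rw [hD] at hQ hR
    exact hmono Q hQ.1 hQ.2 R hR.1 hR.2
  · intro Q hQ R hR h h'
    rw [hD] at hQ hR
    simp only [hT Q hQ.1 hQ.2 R hR.1 hR.2 h h']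
  · intro Q hQ
    rw [hD] at hQ ⊢
    obtain ⟨h1, h2, h3⟩ := hins Q hQ.1 hQ.2 _ (hε Q hQ.1 hQ.2)
    exact ⟨⟨h1, h2⟩, h3⟩
  · intro Q hQ
    rw [hD] at hQ ⊢
    obtain ⟨h1, h2, h3⟩ := hera Q hQ.1 hQ.2 _ (hε Q hQ.1 hQ.2)
    exact ⟨⟨h1, h2⟩, h3⟩

/-! ### Lifted spheres and smallest separating spheres. -/

section LiftedSpheres

variable {n : ℕ} {w : EuclideanSpace ℝ (Fin n) → ℝ}

/-- A sphere with center `z` and squared radius `s` is encoded by the pair `v = (z, s - ‖z‖²)`;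
this is its squared radius. -/
noncomputable def sqRadius (v : EuclideanSpace ℝ (Fin n) × ℝ) : ℝ := ‖v.1‖ ^ 2 + v.2

/-- The power distance of the center of `v` from the weighted point `x`, minus the squared radius
of `v`. It is affine in `v`; it is negative when `x` lies inside the sphere. -/
noncomputable def excess (w : EuclideanSpace ℝ (Fin n) → ℝ) (x : EuclideanSpace ℝ (Fin n))
    (v : EuclideanSpace ℝ (Fin n) × ℝ) : ℝ :=
  ‖x‖ ^ 2 - w x - 2 * inner ℝ x v.1 - v.2

/-- The spheres that include `Q` and exclude `E`. -/
def separatingSpheres (w : EuclideanSpace ℝ (Fin n) → ℝ)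
    (Q E : Finset (EuclideanSpace ℝ (Fin n))) : Set (EuclideanSpace ℝ (Fin n) × ℝ) :=
  {v | (∀ x ∈ Q, excess w x v ≤ 0) ∧ ∀ p ∈ E, 0 ≤ excess w p v}

theorem powerDist_eq_excess_add (x : EuclideanSpace ℝ (Fin n))
    (v : EuclideanSpace ℝ (Fin n) × ℝ) :
    powerDist w x v.1 = excess w x v + sqRadius v := by
  rw [powerDist, excess, sqRadius, dist_eq_norm, norm_sub_sq_real, real_inner_comm]
  ring

theorem sqRadius_mk (z : EuclideanSpace ℝ (Fin n)) (s : ℝ) :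
    sqRadius (z, s - ‖z‖ ^ 2) = s := by
  simp [sqRadius]

theorem excess_mk (x z : EuclideanSpace ℝ (Fin n)) (s : ℝ) :
    excess w x (z, s - ‖z‖ ^ 2) = powerDist w x z - s := by
  have := powerDist_eq_excess_add (w := w) x (z, s - ‖z‖ ^ 2)
  rw [sqRadius_mk] at this
  exact eq_sub_of_add_eq this.symm

theorem continuous_sqRadius :
    Continuous (sqRadius : EuclideanSpace ℝ (Fin n) × ℝ → ℝ) := by
  unfold sqRadius
  fun_prop

theorem continuous_excess (x : EuclideanSpace ℝ (Fin n)) : Continuous (excess w x) := by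
  unfold excess
  fun_prop

theorem excess_comb (x : EuclideanSpace ℝ (Fin n)) (u v : EuclideanSpace ℝ (Fin n) × ℝ)
    {a b : ℝ} (hab : a + b = 1) :
    excess w x (a • u + b • v) = a * excess w x u + b * excess w x v := by
  simp only [excess, Prod.fst_add, Prod.snd_add, Prod.smul_fst, Prod.smul_snd, inner_add_right,
    real_inner_smul_right, smul_eq_mul]
  linear_combination (w x - ‖x‖ ^ 2) * hab

/-- The last term measures strict convexity in the center, which makes smallest spheres unique. -/
theorem sqRadius_comb (u v : EuclideanSpace ℝ (Fin n) × ℝ) {a b : ℝ} (hab : a + b = 1) :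
    sqRadius (a • u + b • v) =
      a * sqRadius u + b * sqRadius v - a * b * ‖u.1 - v.1‖ ^ 2 := by
  simp only [sqRadius, Prod.fst_add, Prod.snd_add, Prod.smul_fst, Prod.smul_snd, smul_eq_mul]
  rw [norm_add_sq_real, norm_sub_sq_real, norm_smul, norm_smul, real_inner_smul_left,
    real_inner_smul_right, mul_pow, mul_pow, Real.norm_eq_abs, Real.norm_eq_abs, sq_abs, sq_abs]
  obtain rfl : b = 1 - a := by linarith
  ring

theorem convexOn_sqRadius :
    ConvexOn ℝ Set.univ (sqRadius : EuclideanSpace ℝ (Fin n) × ℝ → ℝ) := by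
  refine ⟨convex_univ, fun u _ v _ a b ha hb hab => ?_⟩
  rw [sqRadius_comb u v hab, smul_eq_mul, smul_eq_mul]
  have : 0 ≤ a * b * ‖u.1 - v.1‖ ^ 2 := by positivity
  linarith

theorem convex_separatingSpheres (Q E : Finset (EuclideanSpace ℝ (Fin n))) :
    Convex ℝ (separatingSpheres w Q E) := by
  intro u hu v hv a b ha hb hab
  refine ⟨fun x hx => ?_, fun x hx => ?_⟩ <;> rw [excess_comb x u v hab]
  · have := mul_nonneg ha (neg_nonneg.2 (hu.1 x hx))
    have := mul_nonneg hb (neg_nonneg.2 (hv.1 x hx))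
    linarith
  · exact add_nonneg (mul_nonneg ha (hu.2 x hx)) (mul_nonneg hb (hv.2 x hx))

theorem isClosed_separatingSpheres (Q E : Finset (EuclideanSpace ℝ (Fin n))) :
    IsClosed (separatingSpheres w Q E) := by
  have : separatingSpheres w Q E =
      (⋂ x ∈ Q, {v | excess w x v ≤ 0}) ∩ ⋂ p ∈ E, {v | 0 ≤ excess w p v} := by
    ext v
    simp [separatingSpheres]
  rw [this]
  exact (isClosed_biInter fun x _ => isClosed_le (continuous_excess x) continuous_const).inter
    (isClosed_biInter fun x _ => isClosed_le continuous_const (continuous_excess x))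

theorem separatingSpheres_subset {Q Q' E E' : Finset (EuclideanSpace ℝ (Fin n))}
    (hQ : Q ⊆ Q') (hE : E ⊆ E') : separatingSpheres w Q' E' ⊆ separatingSpheres w Q E :=
  fun _ hv => ⟨fun x hx => hv.1 x (hQ hx), fun p hp => hv.2 p (hE hp)⟩

theorem separatingSpheres_insert {Q E : Finset (EuclideanSpace ℝ (Fin n))}
    [DecidableEq (EuclideanSpace ℝ (Fin n))] {v : EuclideanSpace ℝ (Fin n) × ℝ}
    {x : EuclideanSpace ℝ (Fin n)} (hv : v ∈ separatingSpheres w Q E) (hx : excess w x v ≤ 0) :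
    v ∈ separatingSpheres w (insert x Q) E := by
  refine ⟨fun y hy => ?_, hv.2⟩
  rcases Finset.mem_insert.1 hy with rfl | hy
  exacts [hx, hv.1 y hy]

/-- A common point of the Voronoi balls is the center of a separating sphere, with the largest power
distance to `Q` as squared radius; conversely the center of such a sphere is a common point. -/
theorem mem_selectiveDelaunay_iff {X E Q : Finset (EuclideanSpace ℝ (Fin n))} {s : ℝ} :
    Q ∈ selectiveDelaunay w X E s ↔
      Q.Nonempty ∧ Q ⊆ X ∧ ∃ v ∈ separatingSpheres w Q E, sqRadius v ≤ s := by
  refine and_congr_right fun hne => and_congr_right fun _ => ⟨?_, ?_⟩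
  · rintro ⟨y, hy⟩
    simp only [Set.mem_iInter] at hy
    obtain ⟨q, hq, hmax⟩ := Q.exists_max_image (fun x => powerDist w x y) hne
    refine ⟨(y, powerDist w q y - ‖y‖ ^ 2), ⟨fun x hx => ?_, fun p hp => ?_⟩, ?_⟩
    · rw [excess_mk]
      exact sub_nonpos.2 (hmax x hx)
    · rw [excess_mk]
      exact sub_nonneg.2 ((hy q hq).2 p hp)
    · rw [sqRadius_mk]
      exact (hy q hq).1
  · rintro ⟨v, hv, hs⟩
    refine ⟨v.1, Set.mem_iInter₂.2 fun x hx => ⟨?_, fun p hp => ?_⟩⟩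
    · change powerDist w x v.1 ≤ s
      rw [powerDist_eq_excess_add]
      linarith [hv.1 x hx]
    · rw [powerDist_eq_excess_add, powerDist_eq_excess_add]
      linarith [hv.1 x hx, hv.2 p hp]

theorem mem_selectiveDelaunayTop_iff {X E Q : Finset (EuclideanSpace ℝ (Fin n))} :
    Q ∈ selectiveDelaunayTop w X E ↔
      Q.Nonempty ∧ Q ⊆ X ∧ (separatingSpheres w Q E).Nonempty := by
  refine and_congr_right fun hne => and_congr_right fun _ => ⟨?_, ?_⟩
  · rintro ⟨y, hy⟩
    simp only [Set.mem_iInter] at hy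
    obtain ⟨q, hq, hmax⟩ := Q.exists_max_image (fun x => powerDist w x y) hne
    refine ⟨(y, powerDist w q y - ‖y‖ ^ 2), ⟨fun x hx => ?_, fun p hp => ?_⟩⟩
    · rw [excess_mk]
      exact sub_nonpos.2 (hmax x hx)
    · rw [excess_mk]
      exact sub_nonneg.2 (hy q hq p hp)
  · rintro ⟨v, hv⟩
    refine ⟨v.1, Set.mem_iInter₂.2 fun x hx p hp => ?_⟩
    rw [powerDist_eq_excess_add, powerDist_eq_excess_add]
    linarith [hv.1 x hx, hv.2 p hp]

/-- `v` is a smallest sphere that includes `Q` and excludes `E`. -/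
def IsSmallestSeparating (w : EuclideanSpace ℝ (Fin n) → ℝ)
    (Q E : Finset (EuclideanSpace ℝ (Fin n))) (v : EuclideanSpace ℝ (Fin n) × ℝ) : Prop :=
  v ∈ separatingSpheres w Q E ∧ ∀ u ∈ separatingSpheres w Q E, sqRadius v ≤ sqRadius u

theorem isBounded_setOf_sqRadius_le {x : EuclideanSpace ℝ (Fin n)} (c : ℝ) :
    Bornology.IsBounded {v : EuclideanSpace ℝ (Fin n) × ℝ | excess w x v ≤ 0 ∧ sqRadius v ≤ c} := by
  -- The summand 1 ensures `c + w x ≤ r ^ 2`, so the center stays within distance `r` of `x`.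
  set r := 1 + |c + w x| with hr
  set B := Metric.closedBall x r with hB
  have hbdd : Bornology.IsBounded
      ((fun z : EuclideanSpace ℝ (Fin n) => 2 * inner ℝ x z) '' B) :=
    ((isCompact_closedBall x r).image (by fun_prop)).isBounded
  obtain ⟨M, hM⟩ := hbdd.exists_norm_le
  refine ((Metric.isBounded_closedBall (x := x) (r := r)).prod
    (Metric.isBounded_Icc (‖x‖ ^ 2 - w x - M) c)).subset ?_
  rintro v ⟨h1, h2⟩
  have h3 := powerDist_eq_excess_add (w := w) x v
  have h4 : dist v.1 x ^ 2 ≤ c + w x := by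
    rw [powerDist] at h3
    linarith
  have hz : v.1 ∈ B := by
    rw [hB, Metric.mem_closedBall]
    have h5 := le_abs_self (c + w x)
    have h6 := abs_nonneg (c + w x)
    exact abs_le_of_sq_le_sq' (h4.trans (by nlinarith)) (by linarith) |>.2
  have h5 := hM _ ⟨v.1, hz, rfl⟩
  rw [Real.norm_eq_abs] at h5
  have h7 := le_abs_self (2 * inner ℝ x v.1 : ℝ)
  have h8 := sq_nonneg ‖v.1‖
  simp only [excess] at h1
  simp only [sqRadius] at h2
  exact ⟨hz, by constructor <;> linarith⟩

/-- Sublevel sets are compact because a point of `Q` must be included; for empty `Q` the squared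
radius would be unbounded below. -/
theorem exists_isSmallestSeparating {Q E : Finset (EuclideanSpace ℝ (Fin n))} (hQ : Q.Nonempty)
    (h : (separatingSpheres w Q E).Nonempty) : ∃ v, IsSmallestSeparating w Q E v := by
  obtain ⟨u, hu⟩ := h
  obtain ⟨x, hx⟩ := hQ
  set S := separatingSpheres w Q E ∩ {v | sqRadius v ≤ sqRadius u} with hS
  have hc : IsCompact S := by
    refine Metric.isCompact_of_isClosed_isBounded ((isClosed_separatingSpheres Q E).inter
      (isClosed_le continuous_sqRadius continuous_const)) ?_
    exact (isBounded_setOf_sqRadius_le (w := w) (x := x) (sqRadius u)).subset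
      fun v hv => ⟨hv.1.1 x hx, hv.2⟩
  obtain ⟨v, hv, hmin⟩ := hc.exists_isMinOn ⟨u, hu, le_refl (sqRadius u)⟩ continuous_sqRadius.continuousOn
  refine ⟨v, hv.1, fun v' hv' => ?_⟩
  by_cases h : sqRadius v' ≤ sqRadius u
  · exact hmin ⟨hv', h⟩
  · exact hv.2.trans (not_le.1 h).le

theorem IsSmallestSeparating.eq_of_sqRadius_le {Q E : Finset (EuclideanSpace ℝ (Fin n))}
    {u v : EuclideanSpace ℝ (Fin n) × ℝ} (hv : IsSmallestSeparating w Q E v)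
    (hu : u ∈ separatingSpheres w Q E) (h : sqRadius u ≤ sqRadius v) : u = v := by
  have hab : (1 / 2 : ℝ) + 1 / 2 = 1 := by norm_num
  have h1 := hv.2 _ (convex_separatingSpheres Q E hu hv.1 (by norm_num) (by norm_num) hab)
  rw [sqRadius_comb u v hab] at h1
  have h2 : ‖u.1 - v.1‖ ^ 2 = 0 := le_antisymm (by linarith) (sq_nonneg _)
  have h3 : u.1 = v.1 := sub_eq_zero.1 (norm_eq_zero.1 (pow_eq_zero_iff two_ne_zero |>.1 h2))
  have h4 := le_antisymm h (hv.2 u hu)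
  simp only [sqRadius, h3] at h4
  exact Prod.ext h3 (by linarith)

theorem IsSmallestSeparating.insert [DecidableEq (EuclideanSpace ℝ (Fin n))]
    {Q E : Finset (EuclideanSpace ℝ (Fin n))} {v : EuclideanSpace ℝ (Fin n) × ℝ}
    {x : EuclideanSpace ℝ (Fin n)} (hv : IsSmallestSeparating w Q E v) (hx : excess w x v ≤ 0) :
    IsSmallestSeparating w (insert x Q) E v :=
  ⟨separatingSpheres_insert hv.1 hx,
    fun u hu => hv.2 u (separatingSpheres_subset (Finset.subset_insert _ _) subset_rfl hu)⟩

/-- An inactive constraint may be dropped from a convex minimization problem. -/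
theorem isMinOn_separatingSpheres_erase [DecidableEq (EuclideanSpace ℝ (Fin n))]
    {Q E : Finset (EuclideanSpace ℝ (Fin n))} {v : EuclideanSpace ℝ (Fin n) × ℝ}
    {x : EuclideanSpace ℝ (Fin n)} {K : Set (EuclideanSpace ℝ (Fin n) × ℝ)}
    {g : EuclideanSpace ℝ (Fin n) × ℝ → ℝ} (hK : Convex ℝ K) (hg : ConvexOn ℝ Set.univ g)
    (hv : v ∈ separatingSpheres w Q E ∩ K) (hmin : IsMinOn g (separatingSpheres w Q E ∩ K) v)
    (hx : excess w x v < 0) : IsMinOn g (separatingSpheres w (Q.erase x) E ∩ K) v := by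
  refine IsMinOn.of_isLocalMinOn_of_convexOn
    ⟨separatingSpheres_subset (Finset.erase_subset x Q) subset_rfl hv.1, hv.2⟩ ?_
    (hg.subset (Set.subset_univ _) ((convex_separatingSpheres _ E).inter hK))
  -- Near `v` the dropped constraint holds automatically, so `v` is a local minimum of the relaxed
  -- problem, and convexity makes it global.
  have hnear : ∀ᶠ u in nhds v, excess w x u < 0 :=
    (continuous_excess x).continuousAt.eventually_lt continuousAt_const hx
  filter_upwards [nhdsWithin_le_nhds hnear, self_mem_nhdsWithin] with u hu1 hu2
  refine hmin ⟨?_, hu2.2⟩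
  refine separatingSpheres_subset (Q' := insert x (Q.erase x)) ?_ subset_rfl
    (separatingSpheres_insert hu2.1 hu1.le)
  intro y hy
  by_cases h : y = x
  · exact h ▸ Finset.mem_insert_self _ _
  · exact Finset.mem_insert_of_mem (Finset.mem_erase.2 ⟨h, hy⟩)

theorem IsSmallestSeparating.erase [DecidableEq (EuclideanSpace ℝ (Fin n))]
    {Q E : Finset (EuclideanSpace ℝ (Fin n))} {v : EuclideanSpace ℝ (Fin n) × ℝ}
    {x : EuclideanSpace ℝ (Fin n)} (hv : IsSmallestSeparating w Q E v) (hx : excess w x v < 0) :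
    IsSmallestSeparating w (Q.erase x) E v := by
  refine ⟨separatingSpheres_subset (Finset.erase_subset x Q) subset_rfl hv.1, fun u hu => ?_⟩
  exact isMinOn_separatingSpheres_erase (K := Set.univ) convex_univ convexOn_sqRadius
    ⟨hv.1, Set.mem_univ v⟩ (fun u hu => hv.2 u hu.1) hx ⟨hu, Set.mem_univ u⟩

/-- If only `x` had to be included, the sphere could shrink concentrically until it passes through
`x`, and it would still exclude `E`. -/
theorem IsSmallestSeparating.erase_nonempty [DecidableEq (EuclideanSpace ℝ (Fin n))]
    {Q E : Finset (EuclideanSpace ℝ (Fin n))} {v : EuclideanSpace ℝ (Fin n) × ℝ}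
    {x : EuclideanSpace ℝ (Fin n)} (hv : IsSmallestSeparating w Q E v)
    (hx : excess w x v < 0) : (Q.erase x).Nonempty := by
  by_contra h
  rw [Finset.not_nonempty_iff_eq_empty] at h
  have hQx : ∀ y ∈ Q, y = x := fun y hy => by
    by_contra hne
    exact Finset.notMem_empty y (h ▸ Finset.mem_erase.2 ⟨hne, hy⟩)
  have hex : ∀ y, excess w y (v.1, v.2 + excess w x v) = excess w y v - excess w x v := by
    intro y
    simp only [excess]
    ring
  have h1 := hv.2 (v.1, v.2 + excess w x v) ⟨fun y hy => by
      rw [hex, hQx y hy, sub_self], fun p hp => by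
      rw [hex]
      linarith [hv.1.2 p hp]⟩
  simp only [sqRadius] at h1
  linarith

end LiftedSpheres

/-! ### Optimality conditions and general position. -/

section Balanced

variable {n : ℕ} {w : EuclideanSpace ℝ (Fin n) → ℝ}

/-- The derivative of `-excess w y`, for any weights `w`. -/
noncomputable def liftedFunctional (y : EuclideanSpace ℝ (Fin n)) :
    EuclideanSpace ℝ (Fin n) × ℝ →ₗ[ℝ] ℝ :=
  ((2 : ℝ) • (innerSL ℝ y).toLinearMap) ∘ₗ LinearMap.fst ℝ _ _ + LinearMap.snd ℝ _ _

theorem liftedFunctional_apply (y : EuclideanSpace ℝ (Fin n))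
    (d : EuclideanSpace ℝ (Fin n) × ℝ) :
    liftedFunctional y d = 2 * inner ℝ y d.1 + d.2 := by
  simp [liftedFunctional]

theorem excess_add (x : EuclideanSpace ℝ (Fin n)) (v d : EuclideanSpace ℝ (Fin n) × ℝ) :
    excess w x (v + d) = excess w x v - liftedFunctional x d := by
  simp only [excess, liftedFunctional_apply, Prod.fst_add, Prod.snd_add, inner_add_right]
  ring

theorem sqRadius_add (v d : EuclideanSpace ℝ (Fin n) × ℝ) :
    sqRadius (v + d) = sqRadius v + liftedFunctional v.1 d + ‖d.1‖ ^ 2 := by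
  simp only [sqRadius, liftedFunctional_apply, Prod.fst_add, Prod.snd_add, norm_add_sq_real]
  ring

/-- The coefficients of an affine combination that expresses the center of `v` by the points of
`X` on the sphere `v`. -/
def IsBalanced (w : EuclideanSpace ℝ (Fin n) → ℝ) (X : Finset (EuclideanSpace ℝ (Fin n)))
    (v : EuclideanSpace ℝ (Fin n) × ℝ) (ρ : EuclideanSpace ℝ (Fin n) → ℝ) : Prop :=
  ∑ x ∈ X, ρ x = 1 ∧ ∑ x ∈ X, ρ x • x = v.1 ∧ ∀ x ∈ X, ρ x ≠ 0 → excess w x v = 0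

/-- The second-order expansion of `sqRadius` at `v` is exact, and its linear part is the combination
of the functionals at the points of `X` with coefficients `ρ`. -/
theorem IsBalanced.sqRadius_sub {X : Finset (EuclideanSpace ℝ (Fin n))}
    {v : EuclideanSpace ℝ (Fin n) × ℝ} {ρ : EuclideanSpace ℝ (Fin n) → ℝ}
    (h : IsBalanced w X v ρ) (u : EuclideanSpace ℝ (Fin n) × ℝ) :
    sqRadius u - sqRadius v = ‖u.1 - v.1‖ ^ 2 - ∑ x ∈ X, ρ x * excess w x u := by
  have h1 : ∑ x ∈ X, ρ x * excess w x u = -liftedFunctional v.1 (u - v) := by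
    have h2 : ∀ x ∈ X, ρ x * excess w x u =
        -(2 * inner ℝ (ρ x • x) (u.1 - v.1) + ρ x * (u.2 - v.2)) := by
      intro x hx
      have h3 : ρ x * excess w x v = 0 := by
        by_cases h0 : ρ x = 0
        · rw [h0, zero_mul]
        · rw [h.2.2 x hx h0, mul_zero]
      have h4 := excess_add (w := w) x v (u - v)
      rw [add_sub_cancel, liftedFunctional_apply] at h4
      rw [h4, real_inner_smul_left, mul_sub, h3, Prod.fst_sub, Prod.snd_sub]
      ring
    rw [Finset.sum_congr rfl h2, Finset.sum_neg_distrib, Finset.sum_add_distrib,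
      ← Finset.mul_sum, ← Finset.sum_mul, ← sum_inner, h.1, h.2.1, liftedFunctional_apply,
      Prod.fst_sub, Prod.snd_sub, one_mul]
  have h5 := sqRadius_add v (u - v)
  rw [add_sub_cancel, Prod.fst_sub] at h5
  rw [h1, h5]
  ring

theorem IsBalanced.isSmallestSeparating {X Q F : Finset (EuclideanSpace ℝ (Fin n))}
    {v : EuclideanSpace ℝ (Fin n) × ℝ} {ρ : EuclideanSpace ℝ (Fin n) → ℝ}
    (h : IsBalanced w X v ρ) (hv : v ∈ separatingSpheres w Q F)
    (hpos : ∀ x ∈ X, 0 < ρ x → x ∈ Q) (hneg : ∀ x ∈ X, ρ x < 0 → x ∈ F) :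
    IsSmallestSeparating w Q F v := by
  refine ⟨hv, fun u hu => ?_⟩
  have h1 : ∑ x ∈ X, ρ x * excess w x u ≤ 0 := by
    refine Finset.sum_nonpos fun x hx => ?_
    rcases lt_trichotomy (ρ x) 0 with h0 | h0 | h0
    · exact mul_nonpos_of_nonpos_of_nonneg h0.le (hu.2 x (hneg x hx h0))
    · rw [h0, zero_mul]
    · exact mul_nonpos_of_nonneg_of_nonpos h0.le (hu.1 x (hpos x hx h0))
  have h2 := h.sqRadius_sub u
  have h3 := sq_nonneg ‖u.1 - v.1‖
  linarith

/-- With more than `n + 1` points on `v`, any `n + 1` of them span the space and determine the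
center. Then `v` would be their smallest circumsphere, with a further point of `X` on it. -/
theorem InGeneralPosition.affineIndependent_onSphere
    {X : Finset (EuclideanSpace ℝ (Fin n))} (hX : InGeneralPosition w X)
    (v : EuclideanSpace ℝ (Fin n) × ℝ) :
    AffineIndependent ℝ (fun x : X.filter fun x => excess w x v = 0 =>
      (x : EuclideanSpace ℝ (Fin n))) := by
  set A := X.filter fun x => excess w x v = 0 with hA
  have hAX : A ⊆ X := Finset.filter_subset _ _
  refine (hX A hAX ?_).1
  by_contra hcard
  rw [not_le] at hcard
  obtain ⟨B, hBA, hB⟩ := Finset.exists_subset_card_eq hcard.le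
  obtain ⟨hind, hgen⟩ := hX B (hBA.trans hAX) hB.le
  have hspan : vectorSpan ℝ (Set.range fun x : B => (x : EuclideanSpace ℝ (Fin n))) = ⊤ :=
    hind.vectorSpan_eq_top_of_card_eq_finrank_add_one (by simp [hB])
  have hon : ∀ x ∈ A, excess w x v = 0 := fun x hx => (Finset.mem_filter.1 hx).2
  have hcirc : ∀ x ∈ A, powerDist w x v.1 = sqRadius v := fun x hx => by
    rw [powerDist_eq_excess_add, hon x hx, zero_add]
  have huniq : ∀ z s, IsCircumsphere w B z s → z = v.1 := by
    intro z s hz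
    have hle : vectorSpan ℝ (Set.range fun x : B => (x : EuclideanSpace ℝ (Fin n))) ≤
        (Submodule.span ℝ {z - v.1})ᗮ := by
      rw [vectorSpan, Submodule.span_le]
      rintro _ ⟨_, ⟨⟨x, hx⟩, rfl⟩, _, ⟨⟨y, hy⟩, rfl⟩, rfl⟩
      rw [SetLike.mem_coe, Submodule.mem_orthogonal_singleton_iff_inner_left]
      have h1 := hon x (hBA hx)
      have h2 := hon y (hBA hy)
      have h3 := excess_mk (w := w) x z s
      have h4 := excess_mk (w := w) y z s
      rw [hz x hx, sub_self] at h3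
      rw [hz y hy, sub_self] at h4
      simp only [excess] at h1 h2 h3 h4
      simp only [vsub_eq_sub, inner_sub_left, inner_sub_right]
      linarith
    rw [hspan, top_le_iff, Submodule.orthogonal_eq_top_iff, Submodule.span_singleton_eq_bot] at hle
    exact sub_eq_zero.1 hle
  have hBne : B.Nonempty := Finset.card_pos.1 (by omega)
  obtain ⟨q, hq⟩ := hBne
  obtain ⟨p, hpA, hpB⟩ := Finset.exists_mem_notMem_of_card_lt_card (hB.trans_lt hcard)
  refine hgen v.1 (sqRadius v) ⟨fun x hx => hcirc x (hBA hx), fun z s hz => ?_⟩ p (hAX hpA) hpB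
    (hcirc p hpA)
  rw [← hcirc q (hBA hq), ← huniq z s hz]
  exact (hz q hq).le

theorem IsBalanced.eq_of_inGeneralPosition {X : Finset (EuclideanSpace ℝ (Fin n))}
    (hX : InGeneralPosition w X) {v : EuclideanSpace ℝ (Fin n) × ℝ}
    {ρ ρ' : EuclideanSpace ℝ (Fin n) → ℝ} (h : IsBalanced w X v ρ) (h' : IsBalanced w X v ρ')
    {x : EuclideanSpace ℝ (Fin n)} (hx : x ∈ X) : ρ x = ρ' x := by
  have hind := hX.affineIndependent_onSphere v
  set A := X.filter fun x => excess w x v = 0 with hA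
  have hzero : ∀ y ∈ X, y ∉ A → ρ y - ρ' y = 0 := by
    intro y hy hyA
    have hne : ¬excess w y v = 0 := fun h0 => hyA (Finset.mem_filter.2 ⟨hy, h0⟩)
    rw [not_not.1 fun h0 => hne (h.2.2 y hy h0), not_not.1 fun h0 => hne (h'.2.2 y hy h0),
      sub_self]
  rw [affineIndependent_iff] at hind
  by_cases hxA : x ∈ A
  · have h1 := hind Finset.univ (fun y => ρ y - ρ' y) ?_ ?_ ⟨x, hxA⟩ (Finset.mem_univ _)
    · exact sub_eq_zero.1 h1
    · rw [Finset.sum_coe_sort A fun y => ρ y - ρ' y,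
        Finset.sum_subset (Finset.filter_subset _ X) hzero, Finset.sum_sub_distrib, h.1, h'.1,
        sub_self]
    · rw [Finset.sum_coe_sort A fun y => (ρ y - ρ' y) • y,
        Finset.sum_subset (Finset.filter_subset _ X)
          fun y hy hyA => by rw [hzero y hy hyA, zero_smul]]
      simp only [sub_smul]
      rw [Finset.sum_sub_distrib, h.2.1, h'.2.1, sub_self]
  · exact sub_eq_zero.1 (hzero x hx hxA)

/-- First-order optimality: for small `t > 0` the sphere `v + t • d` stays feasible, as inactive
constraints survive and active ones move the right way. Divide the change of `sqRadius` by `t` and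
let `t` tend to 0. -/
theorem IsSmallestSeparating.liftedFunctional_nonneg
    {X Q F : Finset (EuclideanSpace ℝ (Fin n))} (hQX : Q ⊆ X) (hFX : F ⊆ X)
    {v : EuclideanSpace ℝ (Fin n) × ℝ} (hv : IsSmallestSeparating w Q F v)
    (d : EuclideanSpace ℝ (Fin n) × ℝ)
    (hdQ : ∀ x ∈ X, excess w x v = 0 → x ∈ Q → 0 ≤ liftedFunctional x d)
    (hdF : ∀ x ∈ X, excess w x v = 0 → x ∈ F → liftedFunctional x d ≤ 0) :
    0 ≤ liftedFunctional v.1 d := by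
  have htend : ∀ x, Filter.Tendsto (fun t : ℝ => excess w x (v + t • d)) (nhdsWithin 0 (Set.Ioi 0))
      (nhds (excess w x v)) := by
    intro x
    have : Continuous fun t : ℝ => excess w x (v + t • d) :=
      (continuous_excess x).comp (by fun_prop)
    have h := this.tendsto 0
    rw [zero_smul, add_zero] at h
    exact h.mono_left nhdsWithin_le_nhds
  have h1 : ∀ᶠ t : ℝ in nhdsWithin 0 (Set.Ioi 0), v + t • d ∈ separatingSpheres w Q F := by
    refine Filter.Eventually.and ?_ ?_
    · refine (Q.eventually_all).2 fun x hx => ?_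
      rcases (hv.1.1 x hx).lt_or_eq with h0 | h0
      · exact ((htend x).eventually_lt_const h0).mono fun t ht => ht.le
      · filter_upwards [self_mem_nhdsWithin] with t ht
        rw [excess_add, h0, map_smul, smul_eq_mul, zero_sub, neg_nonpos]
        exact mul_nonneg (le_of_lt ht) (hdQ x (hQX hx) h0 hx)
    · refine (F.eventually_all).2 fun x hx => ?_
      rcases (hv.1.2 x hx).lt_or_eq with h0 | h0
      · exact ((htend x).eventually_const_lt h0).mono fun t ht => ht.le
      · filter_upwards [self_mem_nhdsWithin] with t ht
        rw [excess_add, ← h0, map_smul, smul_eq_mul, zero_sub, neg_nonneg]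
        exact mul_nonpos_of_nonneg_of_nonpos (le_of_lt ht) (hdF x (hFX hx) h0.symm hx)
  have h2 : ∀ᶠ t : ℝ in nhdsWithin 0 (Set.Ioi 0),
      0 ≤ liftedFunctional v.1 d + t * ‖d.1‖ ^ 2 := by
    filter_upwards [h1, self_mem_nhdsWithin] with t ht ht0
    have h3 := hv.2 _ ht
    rw [sqRadius_add, map_smul, smul_eq_mul, Prod.smul_fst, norm_smul, mul_pow,
      Real.norm_eq_abs, sq_abs] at h3
    have h4 : 0 ≤ t * (liftedFunctional v.1 d + t * ‖d.1‖ ^ 2) := by linarith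
    exact nonneg_of_mul_nonneg_right h4 ht0
  have h3 : Filter.Tendsto (fun t : ℝ => liftedFunctional v.1 d + t * ‖d.1‖ ^ 2)
      (nhdsWithin 0 (Set.Ioi 0)) (nhds (liftedFunctional v.1 d)) := by
    have : Continuous fun t : ℝ => liftedFunctional v.1 d + t * ‖d.1‖ ^ 2 := by fun_prop
    have h := this.tendsto 0
    rw [zero_mul, add_zero] at h
    exact h.mono_left nhdsWithin_le_nhds
  exact ge_of_tendsto h3 h2

theorem AffineIndependent.linearIndependent_liftedFunctional
    {A : Finset (EuclideanSpace ℝ (Fin n))}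
    (h : AffineIndependent ℝ (fun x : A => (x : EuclideanSpace ℝ (Fin n)))) :
    LinearIndependent ℝ (fun x : A => liftedFunctional (x : EuclideanSpace ℝ (Fin n))) := by
  rw [Fintype.linearIndependent_iff]
  intro g hg i
  rw [affineIndependent_iff] at h
  have hg' : ∀ d : EuclideanSpace ℝ (Fin n) × ℝ,
      ∑ x : A, g x * (2 * inner ℝ (x : EuclideanSpace ℝ (Fin n)) d.1 + d.2) = 0 := by
    intro d
    have := LinearMap.congr_fun hg d
    simpa [LinearMap.sum_apply, liftedFunctional_apply] using this
  refine h Finset.univ g ?_ ?_ i (Finset.mem_univ i)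
  · simpa using hg' (0, 1)
  · refine ext_inner_right ℝ fun u => ?_
    have h1 := hg' (u, 0)
    rw [inner_zero_left, sum_inner]
    simp only [add_zero, mul_left_comm _ (2 : ℝ), ← Finset.mul_sum] at h1
    simp only [real_inner_smul_left]
    linarith

theorem LinearIndependent.exists_dual_vector {V ι : Type*} [AddCommGroup V] [Module ℝ V] [Finite ι]
    {L : ι → V →ₗ[ℝ] ℝ} (h : LinearIndependent ℝ L) (i : ι) :
    ∃ d, L i d = 1 ∧ ∀ j, j ≠ i → L j d = 0 := by
  rw [linearIndependent_iff_notMem_span] at h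
  have h1 : ¬(⨅ j : {j // j ≠ i}, LinearMap.ker (L j)) ≤ LinearMap.ker (L i) := by
    intro hle
    refine h i (Submodule.span_mono ?_ (mem_span_of_iInf_ker_le_ker hle))
    rintro _ ⟨⟨j, hj⟩, rfl⟩
    exact ⟨j, ⟨Set.mem_univ _, hj⟩, rfl⟩
  obtain ⟨d, hd, hdi⟩ := SetLike.not_le_iff_exists.1 h1
  rw [LinearMap.mem_ker] at hdi
  refine ⟨(L i d)⁻¹ • d, by rw [map_smul, smul_eq_mul, inv_mul_cancel₀ hdi], fun j hj => ?_⟩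
  rw [Submodule.mem_iInf] at hd
  rw [map_smul, LinearMap.mem_ker.1 (hd ⟨j, hj⟩), smul_zero]

/-- The Karush–Kuhn–Tucker conditions for the smallest sphere that includes `Q` and excludes
`F`. -/
theorem IsSmallestSeparating.exists_isBalanced {X Q F : Finset (EuclideanSpace ℝ (Fin n))}
    (hX : InGeneralPosition w X) (hQX : Q ⊆ X) (hFX : F ⊆ X)
    {v : EuclideanSpace ℝ (Fin n) × ℝ} (hv : IsSmallestSeparating w Q F v) :
    ∃ ρ, IsBalanced w X v ρ ∧ (∀ x ∈ X, 0 < ρ x → x ∈ Q) ∧ ∀ x ∈ X, ρ x < 0 → x ∈ F := by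
  classical
  have hind := hX.affineIndependent_onSphere v
  set A := X.filter fun x => excess w x v = 0 with hA
  have hmem : ∀ x, x ∈ A ↔ x ∈ X ∧ excess w x v = 0 := fun x => Finset.mem_filter
  have hmin := hv.liftedFunctional_nonneg hQX hFX
  -- If all active functionals vanish on `d`, both `d` and `-d` are admissible, so the derivative at
  -- `v` along `d` is zero.
  have hspan : liftedFunctional v.1 ∈ Submodule.span ℝ
      (Set.range fun x : A => liftedFunctional (x : EuclideanSpace ℝ (Fin n))) := by
    refine mem_span_of_iInf_ker_le_ker fun d hd => ?_
    have hd0 : ∀ x ∈ X, excess w x v = 0 → liftedFunctional x d = 0 := by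
      intro x hx h0
      rw [Submodule.mem_iInf] at hd
      exact LinearMap.mem_ker.1 (hd ⟨x, (hmem x).2 ⟨hx, h0⟩⟩)
    have h1 := hmin d (fun x hx h0 _ => (hd0 x hx h0).ge) fun x hx h0 _ => (hd0 x hx h0).le
    have h2 := hmin (-d) (fun x hx h0 _ => by rw [map_neg, hd0 x hx h0, neg_zero])
      fun x hx h0 _ => by rw [map_neg, hd0 x hx h0, neg_zero]
    rw [map_neg] at h2
    exact LinearMap.mem_ker.2 (le_antisymm (by linarith) h1)
  obtain ⟨c, hc⟩ := (Submodule.mem_span_range_iff_exists_fun ℝ).1 hspan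
  set ρ : EuclideanSpace ℝ (Fin n) → ℝ := fun x => if h : x ∈ A then c ⟨x, h⟩ else 0 with hρ
  have hρA : ∀ x (h : x ∈ A), ρ x = c ⟨x, h⟩ := fun x h => dif_pos h
  have hρ0 : ∀ x, x ∉ A → ρ x = 0 := fun x h => dif_neg h
  have hsum : ∀ d, ∑ x ∈ X, ρ x * liftedFunctional x d = liftedFunctional v.1 d := by
    intro d
    rw [← Finset.sum_subset (Finset.filter_subset _ X)
      (fun y _ hyA => by rw [hρ0 y hyA, zero_mul]), ← hA,
      ← Finset.sum_coe_sort A fun x => ρ x * liftedFunctional x d, ← hc, LinearMap.sum_apply]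
    refine Finset.sum_congr rfl fun x _ => ?_
    rw [hρA x x.2, LinearMap.smul_apply, smul_eq_mul]
  -- A dual direction moves the active constraint of `x` only, so the sign of `ρ x` can be tested by
  -- first-order optimality.
  have hdual : ∀ x ∈ A, ∃ d, liftedFunctional x d = 1 ∧ (∀ y ∈ A, y ≠ x →
      liftedFunctional y d = 0) ∧ liftedFunctional v.1 d = ρ x := by
    intro x hx
    obtain ⟨d, hd1, hd0⟩ := hind.linearIndependent_liftedFunctional.exists_dual_vector ⟨x, hx⟩
    have hd0' : ∀ y ∈ A, y ≠ x → liftedFunctional y d = 0 := fun y hy hne =>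
      hd0 ⟨y, hy⟩ fun h => hne (congrArg Subtype.val h)
    refine ⟨d, hd1, hd0', ?_⟩
    rw [← hsum, Finset.sum_eq_single_of_mem x ((hmem x).1 hx).1]
    · rw [hd1, mul_one]
    · intro y hy hne
      by_cases hyA : y ∈ A
      · rw [hd0' y hyA hne, mul_zero]
      · rw [hρ0 y hyA, zero_mul]
  refine ⟨ρ, ⟨?_, ?_, ?_⟩, ?_, ?_⟩
  · simpa [liftedFunctional_apply] using hsum (0, 1)
  · refine ext_inner_right ℝ fun u => ?_
    have h1 := hsum (u, 0)
    simp only [liftedFunctional_apply, add_zero, mul_left_comm _ (2 : ℝ), ← Finset.mul_sum] at h1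
    simp only [sum_inner, real_inner_smul_left]
    linarith
  · exact fun x _ h0 => ((hmem x).1 (by_contra fun h => h0 (hρ0 x h))).2
  · intro x hx hpos
    by_contra hxQ
    have hxA : x ∈ A := by_contra fun h => hpos.ne' (hρ0 x h)
    obtain ⟨d, hd1, hd0, hdv⟩ := hdual x hxA
    have h1 := hmin (-d) (fun y hy h0 hyQ => ?_) fun y hy h0 hyF => ?_
    · rw [map_neg, hdv] at h1
      linarith
    · rw [map_neg, hd0 y ((hmem y).2 ⟨hy, h0⟩) fun h => hxQ (h ▸ hyQ), neg_zero]
    · rw [map_neg]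
      by_cases h : y = x
      · rw [h, hd1]
        norm_num
      · rw [hd0 y ((hmem y).2 ⟨hy, h0⟩) h, neg_zero]
  · intro x hx hneg
    by_contra hxF
    have hxA : x ∈ A := by_contra fun h => hneg.ne (hρ0 x h)
    obtain ⟨d, hd1, hd0, hdv⟩ := hdual x hxA
    have h1 := hmin d (fun y hy h0 hyQ => ?_) fun y hy h0 hyF => ?_
    · rw [hdv] at h1
      linarith
    · by_cases h : y = x
      · rw [h, hd1]
        norm_num
      · rw [hd0 y ((hmem y).2 ⟨hy, h0⟩) h]
    · rw [hd0 y ((hmem y).2 ⟨hy, h0⟩) fun h => hxF (h ▸ hyF)]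

end Balanced

/-! ### Choice of smallest spheres and the second collapse. -/

section Collapses

variable {n : ℕ} {w : EuclideanSpace ℝ (Fin n) → ℝ}

theorem PreAbstractSimplicialComplex.finite_faces_of_subset {α : Type*} {K : PreAbstractSimplicialComplex α} {X : Finset α}
    (h : ∀ Q ∈ K, Q ⊆ X) : K.faces.Finite :=
  X.powerset.finite_toSet.subset fun Q hQ => Finset.mem_coe.2 (Finset.mem_powerset.2 (h Q hQ))

theorem mem_inf_selectiveDelaunayTop_iff {X E F Q : Finset (EuclideanSpace ℝ (Fin n))} {s : ℝ} :
    Q ∈ selectiveDelaunay w X E s ⊓ selectiveDelaunayTop w X F ↔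
      Q ∈ selectiveDelaunay w X E s ∧ Q ∈ selectiveDelaunayTop w X F :=
  Iff.rfl

theorem exists_smallestSeparating_choice (w : EuclideanSpace ℝ (Fin n) → ℝ)
    (E : Finset (EuclideanSpace ℝ (Fin n))) :
    ∃ m : Finset (EuclideanSpace ℝ (Fin n)) → EuclideanSpace ℝ (Fin n) × ℝ,
      ∀ Q, Q.Nonempty → (separatingSpheres w Q E).Nonempty → IsSmallestSeparating w Q E (m Q) := by
  have h : ∀ Q : Finset (EuclideanSpace ℝ (Fin n)), ∃ v, Q.Nonempty →
      (separatingSpheres w Q E).Nonempty → IsSmallestSeparating w Q E v := by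
    intro Q
    by_cases h1 : Q.Nonempty ∧ (separatingSpheres w Q E).Nonempty
    · obtain ⟨v, hv⟩ := exists_isSmallestSeparating h1.1 h1.2
      exact ⟨v, fun _ _ => hv⟩
    · exact ⟨0, fun h2 h3 => absurd ⟨h2, h3⟩ h1⟩
  choose m hm using h
  exact ⟨m, hm⟩

theorem IsSmallestSeparating.sqRadius_mono {Q R E : Finset (EuclideanSpace ℝ (Fin n))}
    {u v : EuclideanSpace ℝ (Fin n) × ℝ} (hu : IsSmallestSeparating w Q E u)
    (hv : IsSmallestSeparating w R E v) (hQR : Q ⊆ R) : sqRadius u ≤ sqRadius v :=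
  hu.2 v (separatingSpheres_subset hQR subset_rfl hv.1)

theorem IsSmallestSeparating.unique {Q R E : Finset (EuclideanSpace ℝ (Fin n))}
    {u v : EuclideanSpace ℝ (Fin n) × ℝ} (hu : IsSmallestSeparating w Q E u)
    (hv : IsSmallestSeparating w R E v) (hQR : Q ⊆ R) (h : sqRadius v ≤ sqRadius u) : v = u :=
  hu.eq_of_sqRadius_le (separatingSpheres_subset hQR subset_rfl hv.1) h

theorem mem_selectiveDelaunay_iff_of_isSmallest {X E Q : Finset (EuclideanSpace ℝ (Fin n))}
    {s : ℝ} {v : EuclideanSpace ℝ (Fin n) × ℝ} (hv : IsSmallestSeparating w Q E v) :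
    Q ∈ selectiveDelaunay w X E s ↔ Q.Nonempty ∧ Q ⊆ X ∧ sqRadius v ≤ s := by
  rw [mem_selectiveDelaunay_iff]
  refine and_congr_right fun _ => and_congr_right fun _ => ⟨?_, fun h => ⟨v, hv.1, h⟩⟩
  rintro ⟨u, hu, hs⟩
  exact (hv.2 u hu).trans hs

theorem selectiveDelaunay_le_of_subset {X E F : Finset (EuclideanSpace ℝ (Fin n))} (hEF : E ⊆ F)
    (s : ℝ) : selectiveDelaunay w X F s ≤
      selectiveDelaunay w X E s ⊓ selectiveDelaunayTop w X F := by
  intro Q hQ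
  obtain ⟨h1, h2, v, hv, hs⟩ := mem_selectiveDelaunay_iff.1 hQ
  exact ⟨mem_selectiveDelaunay_iff.2 ⟨h1, h2, v, separatingSpheres_subset subset_rfl hEF hv, hs⟩,
    mem_selectiveDelaunayTop_iff.2 ⟨h1, h2, v, hv⟩⟩

theorem collapses_inf_selectiveDelaunay {X E F : Finset (EuclideanSpace ℝ (Fin n))}
    (hX : InGeneralPosition w X) (hEF : E ⊆ F) (hFX : F ⊆ X) (s : ℝ) :
    Collapses (selectiveDelaunay w X E s ⊓ selectiveDelaunayTop w X F)
      (selectiveDelaunay w X F s) := by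
  classical
  obtain ⟨mE, hmE⟩ := exists_smallestSeparating_choice w E
  obtain ⟨mF, hmF⟩ := exists_smallestSeparating_choice w F
  have hdata : ∀ Q, Q ∈ selectiveDelaunay w X E s ⊓ selectiveDelaunayTop w X F →
      Q.Nonempty ∧ Q ⊆ X ∧ IsSmallestSeparating w Q E (mE Q) ∧
        IsSmallestSeparating w Q F (mF Q) ∧ sqRadius (mE Q) ≤ s := by
    intro Q hQ
    obtain ⟨h1, h2⟩ := mem_inf_selectiveDelaunayTop_iff.1 hQ
    obtain ⟨hne, hQX, v, hv⟩ := mem_selectiveDelaunayTop_iff.1 h2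
    have hE := hmE Q hne ⟨v, separatingSpheres_subset subset_rfl hEF hv⟩
    exact ⟨hne, hQX, hE, hmF Q hne ⟨v, hv⟩,
      ((mem_selectiveDelaunay_iff_of_isSmallest hE).1 h1).2.2⟩
  have hout : ∀ Q, Q ∈ selectiveDelaunay w X E s ⊓ selectiveDelaunayTop w X F →
      Q ∉ selectiveDelaunay w X F s → s < sqRadius (mF Q) := by
    intro Q hQ hQ'
    obtain ⟨hne, hQX, -, hF, -⟩ := hdata Q hQ
    by_contra h
    exact hQ' ((mem_selectiveDelaunay_iff_of_isSmallest hF).2 ⟨hne, hQX, not_lt.1 h⟩)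
  have hstable : ∀ Q R, Q ∈ selectiveDelaunay w X E s ⊓ selectiveDelaunayTop w X F →
      Q ∉ selectiveDelaunay w X F s → R.Nonempty → R ⊆ X →
      IsSmallestSeparating w R E (mE Q) → IsSmallestSeparating w R F (mF Q) →
      R ∈ selectiveDelaunay w X E s ⊓ selectiveDelaunayTop w X F ∧
        R ∉ selectiveDelaunay w X F s ∧
        sqRadius (mE R) + sqRadius (mF R) = sqRadius (mE Q) + sqRadius (mF Q) := by
    intro Q R hQ hQ' hR hRX hE hF
    have hs := hout Q hQ hQ'
    obtain ⟨-, -, -, -, hs'⟩ := hdata Q hQ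
    have h1 : R ∈ selectiveDelaunay w X E s ⊓ selectiveDelaunayTop w X F :=
      ⟨(mem_selectiveDelaunay_iff_of_isSmallest hE).2 ⟨hR, hRX, hs'⟩,
        mem_selectiveDelaunayTop_iff.2 ⟨hR, hRX, mF Q, hF.1⟩⟩
    obtain ⟨-, -, hE', hF', -⟩ := hdata R h1
    refine ⟨h1, fun h => ?_, ?_⟩
    · exact absurd ((mem_selectiveDelaunay_iff_of_isSmallest hF).1 h).2.2 (not_le.2 hs)
    · rw [le_antisymm (hE'.2 _ hE.1) (hE.2 _ hE'.1), le_antisymm (hF'.2 _ hF.1) (hF.2 _ hF'.1)]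
  refine collapses_of_pairing _ _ (selectiveDelaunay_le_of_subset hEF s)
    (PreAbstractSimplicialComplex.finite_faces_of_subset fun Q hQ => (hdata Q hQ).2.1)
    (fun Q => sqRadius (mE Q) + sqRadius (mF Q))
    -- This set depends on `Q` only through the two smallest spheres, hence is constant along faces
    -- of equal value.
    (fun Q => {p | p ∈ X ∧ excess w p (mE Q) < 0 ∧ ∃ ρ, IsBalanced w X (mF Q) ρ ∧ ρ p < 0})
    ?_ ?_ ?_ ?_ ?_
  · intro Q hQ _ R hR _ hQR
    obtain ⟨-, -, hE, hF, -⟩ := hdata Q hQ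
    obtain ⟨-, -, hE', hF', -⟩ := hdata R hR
    exact add_le_add (hE.sqRadius_mono hE' hQR) (hF.sqRadius_mono hF' hQR)
  · intro Q hQ _ R hR _ hQR h
    obtain ⟨-, -, hE, hF, -⟩ := hdata Q hQ
    obtain ⟨-, -, hE', hF', -⟩ := hdata R hR
    have h1 := hE.sqRadius_mono hE' hQR
    have h2 := hF.sqRadius_mono hF' hQR
    rw [hE.unique hE' hQR (by linarith), hF.unique hF' hQR (by linarith)]
  · intro Q hQ hQ'
    obtain ⟨-, hQX, hE, hF, hs⟩ := hdata Q hQ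
    obtain ⟨ρ, hρ, hpos, hneg⟩ := hF.exists_isBalanced hX hQX hFX
    have h1 := hρ.sqRadius_sub (mE Q)
    have h2 := hout Q hQ hQ'
    have h3 := sq_nonneg ‖(mE Q).1 - (mF Q).1‖
    -- Since `mE Q` has smaller squared radius than `mF Q`, the weighted sum of excesses is
    -- positive. A positive summand with `0 < ρ p` would put `p` in `Q` but outside `mE Q`.
    obtain ⟨p, hp, hlt⟩ := Finset.exists_lt_of_sum_lt
      (show ∑ x ∈ X, (0 : ℝ) < ∑ x ∈ X, ρ x * excess w x (mE Q) by
        rw [Finset.sum_const_zero]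
        linarith)
    rcases pos_and_pos_or_neg_and_neg_of_mul_pos hlt with h | h
    · exact absurd (hE.1.1 p (hpos p hp h.1)) (not_le.2 h.2)
    · exact ⟨p, hp, h.2, ρ, hρ, h.1⟩
  · rintro Q hQ hQ' p ⟨hpX, hpE, ρ, hρ, hρp⟩
    obtain ⟨-, hQX, hE, hF, -⟩ := hdata Q hQ
    exact hstable Q _ hQ hQ' (Finset.insert_nonempty _ _) (Finset.insert_subset hpX hQX)
      (hE.insert hpE.le) (hF.insert (hρ.2.2 p hpX hρp.ne).le)
  · rintro Q hQ hQ' p ⟨hpX, hpE, ρ, hρ, hρp⟩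
    obtain ⟨-, hQX, hE, hF, -⟩ := hdata Q hQ
    obtain ⟨ρ', hρ', hpos, hneg⟩ := hF.exists_isBalanced hX hQX hFX
    -- By uniqueness of coefficients, `p` is not among the points with positive coefficient, so `ρ'`
    -- still certifies optimality after `p` is erased from `Q`.
    have hρp' : ρ' p < 0 := (hρ'.eq_of_inGeneralPosition hX hρ hpX).trans_lt hρp
    refine hstable Q _ hQ hQ' (hE.erase_nonempty hpE) ((Finset.erase_subset _ _).trans hQX)
      (hE.erase hpE) (hρ'.isSmallestSeparating
        (separatingSpheres_subset (Finset.erase_subset _ _) subset_rfl hF.1) ?_ hneg)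
    exact fun x hx h0 => Finset.mem_erase.2 ⟨fun h => by
      rw [h] at h0
      linarith, hpos x hx h0⟩

/-! ### The first collapse, by a penalty. -/

/-- The penalty for the points of `F` inside the sphere `v`. -/
noncomputable def inclusionPenalty (w : EuclideanSpace ℝ (Fin n) → ℝ)
    (F : Finset (EuclideanSpace ℝ (Fin n))) (v : EuclideanSpace ℝ (Fin n) × ℝ) : ℝ :=
  ∑ p ∈ F, max 0 (-excess w p v) ^ 2

theorem inclusionPenalty_nonneg (F : Finset (EuclideanSpace ℝ (Fin n)))
    (v : EuclideanSpace ℝ (Fin n) × ℝ) : 0 ≤ inclusionPenalty w F v :=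
  Finset.sum_nonneg fun _ _ => sq_nonneg _

theorem continuous_inclusionPenalty (F : Finset (EuclideanSpace ℝ (Fin n))) :
    Continuous (inclusionPenalty w F) :=
  continuous_finsetSum F fun p _ => (continuous_const.max (continuous_excess p).neg).pow 2

theorem inclusionPenalty_eq_zero_iff {F : Finset (EuclideanSpace ℝ (Fin n))}
    {v : EuclideanSpace ℝ (Fin n) × ℝ} :
    inclusionPenalty w F v = 0 ↔ ∀ p ∈ F, 0 ≤ excess w p v := by
  rw [inclusionPenalty, Finset.sum_eq_zero_iff_of_nonneg fun _ _ => sq_nonneg _]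
  simp

theorem max_zero_neg_excess_comb_le (x : EuclideanSpace ℝ (Fin n))
    (u v : EuclideanSpace ℝ (Fin n) × ℝ) {a b : ℝ} (ha : 0 ≤ a) (hb : 0 ≤ b) (hab : a + b = 1) :
    max 0 (-excess w x (a • u + b • v)) ≤
      a * max 0 (-excess w x u) + b * max 0 (-excess w x v) := by
  rw [excess_comb x u v hab]
  have h1 := mul_le_mul_of_nonneg_left (le_max_right 0 (-excess w x u)) ha
  have h2 := mul_le_mul_of_nonneg_left (le_max_right 0 (-excess w x v)) hb
  have h3 := mul_nonneg ha (le_max_left 0 (-excess w x u))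
  have h4 := mul_nonneg hb (le_max_left 0 (-excess w x v))
  exact max_le (by linarith) (by linarith)

theorem inclusionPenalty_comb_le (F : Finset (EuclideanSpace ℝ (Fin n)))
    (u v : EuclideanSpace ℝ (Fin n) × ℝ) {a b : ℝ} (ha : 0 ≤ a) (hb : 0 ≤ b) (hab : a + b = 1) :
    inclusionPenalty w F (a • u + b • v) ≤
      a * inclusionPenalty w F u + b * inclusionPenalty w F v -
        a * b * ∑ p ∈ F, (max 0 (-excess w p u) - max 0 (-excess w p v)) ^ 2 := by
  simp only [inclusionPenalty, Finset.mul_sum]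
  rw [← Finset.sum_add_distrib, ← Finset.sum_sub_distrib]
  refine Finset.sum_le_sum fun p _ => ?_
  refine (pow_le_pow_left₀ (le_max_left _ _)
    (max_zero_neg_excess_comb_le p u v ha hb hab) 2).trans_eq ?_
  obtain rfl : b = 1 - a := by linarith
  ring

theorem convexOn_inclusionPenalty (F : Finset (EuclideanSpace ℝ (Fin n))) :
    ConvexOn ℝ Set.univ (inclusionPenalty w F) := by
  refine ⟨convex_univ, fun u _ v _ a b ha hb hab => ?_⟩
  refine (inclusionPenalty_comb_le F u v ha hb hab).trans (sub_le_self _ ?_)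
  exact mul_nonneg (mul_nonneg ha hb) (Finset.sum_nonneg fun _ _ => sq_nonneg _)

/-- The minimizer need not be unique, but by strict convexity of the square, averaging two
minimizers shows that their penalty terms agree point by point. -/
theorem excess_neg_iff_of_isMinOn_inclusionPenalty {F : Finset (EuclideanSpace ℝ (Fin n))}
    {S : Set (EuclideanSpace ℝ (Fin n) × ℝ)} (hS : Convex ℝ S)
    {u v : EuclideanSpace ℝ (Fin n) × ℝ} (hu : u ∈ S) (hv : v ∈ S)
    (hmin : IsMinOn (inclusionPenalty w F) S u)
    (hle : inclusionPenalty w F v ≤ inclusionPenalty w F u)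
    {p : EuclideanSpace ℝ (Fin n)} (hp : p ∈ F) : excess w p u < 0 ↔ excess w p v < 0 := by
  have hab : (1 / 2 : ℝ) + 1 / 2 = 1 := by norm_num
  have h1 : inclusionPenalty w F u ≤ inclusionPenalty w F ((1 / 2 : ℝ) • u + (1 / 2 : ℝ) • v) :=
    hmin (hS hu hv (by norm_num) (by norm_num) hab)
  have h2 := inclusionPenalty_comb_le (w := w) F u v (by norm_num) (by norm_num) hab
  have h3 : ∑ p ∈ F, (max 0 (-excess w p u) - max 0 (-excess w p v)) ^ 2 = 0 :=
    le_antisymm (by linarith) (Finset.sum_nonneg fun _ _ => sq_nonneg _)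
  rw [Finset.sum_eq_zero_iff_of_nonneg fun _ _ => sq_nonneg _] at h3
  have h4 := sub_eq_zero.1 (pow_eq_zero_iff two_ne_zero |>.1 (h3 p hp))
  have h5 : ∀ t : ℝ, t < 0 ↔ 0 < max 0 (-t) := fun t => by simp
  rw [h5, h5, h4]

/-- Otherwise the penalties at `u` and `v` come from disjoint sets of points, the mixed terms vanish
on the segment between them, and moving from `u` towards `v` lowers the penalty. -/
theorem exists_excess_neg_of_isMinOn_inclusionPenalty {F : Finset (EuclideanSpace ℝ (Fin n))}
    {S : Set (EuclideanSpace ℝ (Fin n) × ℝ)} (hS : Convex ℝ S)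
    {u v : EuclideanSpace ℝ (Fin n) × ℝ} (hu : u ∈ S) (hv : v ∈ S)
    (hmin : IsMinOn (inclusionPenalty w F) S u) (hpos : 0 < inclusionPenalty w F u) :
    ∃ p ∈ F, excess w p v < 0 ∧ excess w p u < 0 := by
  by_contra! hcon
  set g := inclusionPenalty w F u with hg
  set h := inclusionPenalty w F v with hh
  have hh0 : 0 ≤ h := inclusionPenalty_nonneg F v
  -- This minimizes `(1 - b) ^ 2 * g + b ^ 2 * h`, with value `g - b * g`.
  set b := g / (g + h) with hb
  have hb0 : 0 < b := by positivity
  have hb1 : b ≤ 1 := (div_le_one (by positivity)).2 (by linarith)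
  have hbg : b * (g + h) = g := div_mul_cancel₀ _ (by positivity)
  have hab : (1 - b) + b = 1 := by ring
  have h1 : g ≤ inclusionPenalty w F ((1 - b) • u + b • v) :=
    hmin (hS hu hv (by linarith) hb0.le hab)
  have h2 : inclusionPenalty w F ((1 - b) • u + b • v) ≤ (1 - b) ^ 2 * g + b ^ 2 * h := by
    rw [hg, hh]
    simp only [inclusionPenalty, Finset.mul_sum]
    rw [← Finset.sum_add_distrib]
    refine Finset.sum_le_sum fun p hp => ?_
    have h3 := pow_le_pow_left₀ (le_max_left _ _)
      (max_zero_neg_excess_comb_le (w := w) p u v (sub_nonneg.2 hb1) hb0.le hab) 2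
    refine h3.trans_eq ?_
    have h4 : max 0 (-excess w p u) * max 0 (-excess w p v) = 0 := by
      by_cases h5 : excess w p v < 0
      · rw [max_eq_left (neg_nonpos.2 (hcon p hp h5)), zero_mul]
      · rw [max_eq_left (neg_nonpos.2 (not_lt.1 h5)), mul_zero]
    linear_combination 2 * (1 - b) * b * h4
  have h3 : b * (2 * g) ≤ b * g := by nlinarith
  have h4 := le_of_mul_le_mul_left h3 hb0
  linarith

theorem collapses_selectiveDelaunay_inf {X E F : Finset (EuclideanSpace ℝ (Fin n))}
    (hEF : E ⊆ F) (hFX : F ⊆ X) (s : ℝ) :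
    Collapses (selectiveDelaunay w X E s)
      (selectiveDelaunay w X E s ⊓ selectiveDelaunayTop w X F) := by
  classical
  obtain ⟨mE, hmE⟩ := exists_smallestSeparating_choice w E
  obtain ⟨mF, hmF⟩ := exists_smallestSeparating_choice w F
  -- Penalty minimizers may escape to infinity. A ball containing all chosen spheres restores
  -- compactness, and it is large enough to retain a sphere of penalty zero whenever `Q` can be
  -- separated from `F`.
  obtain ⟨r, hr⟩ := (X.powerset.image mE ∪ X.powerset.image mF).finite_toSet.isBounded
    |>.subset_closedBall 0
  set B := Metric.closedBall (0 : EuclideanSpace ℝ (Fin n) × ℝ) r with hB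
  have hBE : ∀ Q, Q ⊆ X → mE Q ∈ B := fun Q hQ => hr (Finset.mem_coe.2
    (Finset.mem_union_left _ (Finset.mem_image_of_mem mE (Finset.mem_powerset.2 hQ))))
  have hBF : ∀ Q, Q ⊆ X → mF Q ∈ B := fun Q hQ => hr (Finset.mem_coe.2
    (Finset.mem_union_right _ (Finset.mem_image_of_mem mF (Finset.mem_powerset.2 hQ))))
  have hconv : ∀ Q, Convex ℝ (separatingSpheres w Q E ∩ B) := fun Q =>
    (convex_separatingSpheres Q E).inter (convex_closedBall 0 r)
  have hex : ∀ Q, ∃ v, (separatingSpheres w Q E ∩ B).Nonempty →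
      v ∈ separatingSpheres w Q E ∩ B ∧
        IsMinOn (inclusionPenalty w F) (separatingSpheres w Q E ∩ B) v := by
    intro Q
    by_cases h : (separatingSpheres w Q E ∩ B).Nonempty
    · obtain ⟨v, hv, hmin⟩ := ((isCompact_closedBall 0 r).inter_left
        (isClosed_separatingSpheres Q E)).exists_isMinOn h
          (continuous_inclusionPenalty F).continuousOn
      exact ⟨v, fun _ => ⟨hv, hmin⟩⟩
    · exact ⟨0, fun h' => absurd h' h⟩
  choose m hm using hex
  have hdata : ∀ Q, Q ∈ selectiveDelaunay w X E s →
      Q.Nonempty ∧ Q ⊆ X ∧ IsSmallestSeparating w Q E (mE Q) ∧ sqRadius (mE Q) ≤ s ∧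
        m Q ∈ separatingSpheres w Q E ∩ B ∧
        IsMinOn (inclusionPenalty w F) (separatingSpheres w Q E ∩ B) (m Q) := by
    intro Q hQ
    obtain ⟨hne, hQX, v, hv, -⟩ := mem_selectiveDelaunay_iff.1 hQ
    have hE := hmE Q hne ⟨v, hv⟩
    obtain ⟨h1, h2⟩ := hm Q ⟨mE Q, hE.1, hBE Q hQX⟩
    exact ⟨hne, hQX, hE, ((mem_selectiveDelaunay_iff_of_isSmallest hE).1 hQ).2.2, h1, h2⟩
  have hout : ∀ Q, Q ∈ selectiveDelaunay w X E s →
      (Q ∉ selectiveDelaunay w X E s ⊓ selectiveDelaunayTop w X F ↔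
        0 < inclusionPenalty w F (m Q)) := by
    intro Q hQ
    obtain ⟨hne, hQX, -, -, h1, h2⟩ := hdata Q hQ
    rw [mem_inf_selectiveDelaunayTop_iff, mem_selectiveDelaunayTop_iff]
    constructor
    · intro h
      refine (inclusionPenalty_nonneg F _).lt_of_ne' fun h0 => h ⟨hQ, hne, hQX, m Q, h1.1.1, ?_⟩
      exact inclusionPenalty_eq_zero_iff.1 h0
    · rintro hpos ⟨-, -, -, hF⟩
      have hF' := (hmF Q hne hF).1
      have h3 : inclusionPenalty w F (m Q) ≤ inclusionPenalty w F (mF Q) :=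
        h2 ⟨separatingSpheres_subset subset_rfl hEF hF', hBF Q hQX⟩
      rw [inclusionPenalty_eq_zero_iff.2 hF'.2] at h3
      exact absurd h3 (not_le.2 hpos)
  have hstable : ∀ Q R, Q ∈ selectiveDelaunay w X E s →
      Q ∉ selectiveDelaunay w X E s ⊓ selectiveDelaunayTop w X F → R.Nonempty → R ⊆ X →
      IsSmallestSeparating w R E (mE Q) → m Q ∈ separatingSpheres w R E ∩ B →
      IsMinOn (inclusionPenalty w F) (separatingSpheres w R E ∩ B) (m Q) →
      R ∈ selectiveDelaunay w X E s ∧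
        R ∉ selectiveDelaunay w X E s ⊓ selectiveDelaunayTop w X F ∧
        sqRadius (mE R) + inclusionPenalty w F (m R) =
          sqRadius (mE Q) + inclusionPenalty w F (m Q) := by
    intro Q R hQ hQ' hR hRX hE hmR hmin
    obtain ⟨-, -, -, hs, -, -⟩ := hdata Q hQ
    have h1 : R ∈ selectiveDelaunay w X E s :=
      (mem_selectiveDelaunay_iff_of_isSmallest hE).2 ⟨hR, hRX, hs⟩
    obtain ⟨-, -, hE', -, hmR', hmin'⟩ := hdata R h1
    have h2 : inclusionPenalty w F (m R) = inclusionPenalty w F (m Q) :=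
      le_antisymm (hmin' hmR) (hmin hmR')
    refine ⟨h1, ?_, ?_⟩
    · rw [hout R h1, h2, ← hout Q hQ]
      exact hQ'
    · rw [h2, le_antisymm (hE'.2 _ hE.1) (hE.2 _ hE'.1)]
  have hpen : ∀ Q R, Q ∈ selectiveDelaunay w X E s → R ∈ selectiveDelaunay w X E s → Q ⊆ R →
      m R ∈ separatingSpheres w Q E ∩ B ∧
        inclusionPenalty w F (m Q) ≤ inclusionPenalty w F (m R) := by
    intro Q R hQ hR hQR
    obtain ⟨-, -, -, -, -, hmin⟩ := hdata Q hQ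
    obtain ⟨-, -, -, -, hmR, -⟩ := hdata R hR
    have h1 : m R ∈ separatingSpheres w Q E ∩ B :=
      ⟨separatingSpheres_subset hQR subset_rfl hmR.1, hmR.2⟩
    exact ⟨h1, hmin h1⟩
  refine collapses_of_pairing _ _ inf_le_left
    (PreAbstractSimplicialComplex.finite_faces_of_subset fun Q hQ => (hdata Q hQ).2.1)
    (fun Q => sqRadius (mE Q) + inclusionPenalty w F (m Q))
    -- Strictly inside `mE Q` and `m Q`, such a point imposes an inactive constraint in both
    -- problems, so it may be added or dropped.
    (fun Q => {p | p ∈ F ∧ excess w p (mE Q) < 0 ∧ excess w p (m Q) < 0})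
    ?_ ?_ ?_ ?_ ?_
  · intro Q hQ _ R hR _ hQR
    exact add_le_add ((hdata Q hQ).2.2.1.sqRadius_mono (hdata R hR).2.2.1 hQR)
      (hpen Q R hQ hR hQR).2
  · intro Q hQ _ R hR _ hQR h
    obtain ⟨-, -, hE, -, hmQ, hmin⟩ := hdata Q hQ
    obtain ⟨-, -, hE', -, -, -⟩ := hdata R hR
    have h1 := hE.sqRadius_mono hE' hQR
    obtain ⟨h2, h3⟩ := hpen Q R hQ hR hQR
    rw [hE.unique hE' hQR (by linarith)]
    ext p
    refine and_congr_right fun hp => and_congr_right fun _ => ?_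
    exact excess_neg_iff_of_isMinOn_inclusionPenalty (hconv Q) hmQ h2 hmin (by linarith) hp
  · intro Q hQ hQ'
    obtain ⟨-, hQX, hE, -, hmQ, hmin⟩ := hdata Q hQ
    exact exists_excess_neg_of_isMinOn_inclusionPenalty (hconv Q) hmQ ⟨hE.1, hBE Q hQX⟩ hmin
      ((hout Q hQ).1 hQ')
  · rintro Q hQ hQ' p ⟨hpF, hpE, hpm⟩
    obtain ⟨-, hQX, hE, -, hmQ, hmin⟩ := hdata Q hQ
    refine hstable Q _ hQ hQ' (Finset.insert_nonempty _ _) (Finset.insert_subset (hFX hpF) hQX)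
      (hE.insert hpE.le) ⟨separatingSpheres_insert hmQ.1 hpm.le, hmQ.2⟩ ?_
    exact hmin.on_subset (Set.inter_subset_inter_left _
      (separatingSpheres_subset (Finset.subset_insert _ _) subset_rfl))
  · rintro Q hQ hQ' p ⟨hpF, hpE, hpm⟩
    obtain ⟨-, hQX, hE, -, hmQ, hmin⟩ := hdata Q hQ
    exact hstable Q _ hQ hQ' (hE.erase_nonempty hpE) ((Finset.erase_subset _ _).trans hQX)
      (hE.erase hpE)
      ⟨separatingSpheres_subset (Finset.erase_subset _ _) subset_rfl hmQ.1, hmQ.2⟩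
      (isMinOn_separatingSpheres_erase (convex_closedBall 0 r) (convexOn_inclusionPenalty F) hmQ
        hmin hpm)

end Collapses

theorem mainTheorem2 (n : ℕ) (w : EuclideanSpace ℝ (Fin n) → ℝ)
    (X E F : Finset (EuclideanSpace ℝ (Fin n))) (hX : InGeneralPosition w X)
    (hEF : E ⊆ F) (hFX : F ⊆ X) (s : ℝ) :
    Collapses (selectiveDelaunay w X E s)
      (selectiveDelaunay w X E s ⊓ selectiveDelaunayTop w X F) ∧
    Collapses (selectiveDelaunay w X E s ⊓ selectiveDelaunayTop w X F)
      (selectiveDelaunay w X F s) :=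
  ⟨collapses_selectiveDelaunay_inf hEF hFX s, collapses_inf_selectiveDelaunay hX hEF hFX s⟩
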